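/- Let $\mathcal{G}=(V,\mathcal{E})$ be a finite hypergraph (every hyperedge has at least two vertices; parallel hyperedges are allowed), let $k$ be a positive integer, $K=\{1,\dots,k\}$, and let $\ell,\ell':K\cup\{0\}\to\mathbb{Z}_{>0}$ satisfy $$\ell'(K)\ \ge\ \ell'(0)\ \ge\ \ell(0)\ \ge\ \ell(K)\qquad\text{and}\qquad |V|\ \ge\ \ell'(i)\ \ge\ \ell(i)\quad\text{for every } 1\le i\le k,$$ where $m(K)=\sum_{i=1}^k m(i)$. For an integer $p$ put $m_p(i)=\min\{m(i),p\}$. For a partition $\mathcal{P}$ of $V$ let $e_{\mathcal{E}}(\mathcal{P})$ be the number of hyperedges that enter some member of $\mathcal{P}$, where a hyperedge enters $X\subseteq V$ if it has a vertex in $X$ and a vertex in $V\setminus X$. A digraph $(U,F)$ is an $S$-branching if $S\subseteq U$ and every $u\in U$ is reached from $S$ along exactly one directed walk, the trivial walk being allowed (equivalently: roots in $S$ have in-degree $0$, all other vertices have in-degree $1$, and there is no directed cycle). Orienting a hyperedge means choosing one of its vertices as head, the others becoming tails; trimming a hyperarc means replacing it by an arc from one of its tails to its head. A directed hypergraph $\mathcal{B}$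 is an $S$-hyperbranching if $S$ is a set of vertices of $\mathcal{B}$ and its hyperarcs can be trimmed to an arc set $F$ such that $(C,F)$ is an $S$-branching, where the core $C$ consists of $S$ and of all vertices that are the head of at least one hyperarc of $\mathcal{B}$. A subhypergraph $\mathcal{T}$ of $\mathcal{G}$ is a spanning $S$-hyperforest if it can be oriented to an $S$-hyperbranching with core $V$. A packing is a family of such subhypergraphs that are pairwise hyperedge-disjoint. Then there exist sets $S_1,\dots,S_k\subseteq V$ and a packing of $k$ spanning $S_i$-hyperforests $B_i$ $(1\le i\le k)$ in $\mathcal{G}$ such that $$\ell(i)\le |S_i|\le \ell'(i)\quad\text{for every } 1\le i\le k,\qquad \ell(0)\le\sum_{i=1}^k|S_i|\le\ell'(0)$$ if and only if $$\ell'(0)-\ell(K)+\ell_{|\mathcal{P}|}(K)+e_{\mathcal{E}}(\mathcal{P})\ \ge\ k|\mathcal{P}|\quad\text{for every partition }\mathcal{P}\text{ of }V,$$ $$\ell'_{|\mathcal{P}|}(K)+e_{\mathcal{E}}(\mathcal{P})\ \ge\ k|\mathcal{P}|\quad\text{for every partition }\mathcal{P}\text{ of }V.$$ -/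

import Mathlib

/-- A finite hypergraph `(V, 𝓔)` with vertices from `V` and hyperedges named by elements of `E`.
Distinct names may have the same set of ends, so parallel hyperedges are allowed. Only the values
`ends e` with `e ∈ edges` matter. -/
structure MultiHypergraph (V E : Type*) where
  verts : Finset V
  edges : Finset E
  ends : E → Finset V
  ends_subset : ∀ e ∈ edges, ends e ⊆ verts
  two_le_card : ∀ e ∈ edges, 2 ≤ (ends e).card

/-- A finite directed hypergraph: every hyperarc has exactly one head and at least one tail,
and the head is not a tail. -/
structure Dypergraph (V A : Type*) where
  verts : Finset V
  arcs : Finset A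
  head : A → V
  tails : A → Finset V
  head_mem : ∀ a ∈ arcs, head a ∈ verts
  tails_subset : ∀ a ∈ arcs, tails a ⊆ verts
  tails_nonempty : ∀ a ∈ arcs, (tails a).Nonempty
  head_notMem_tails : ∀ a ∈ arcs, head a ∉ tails a

/-- In the digraph with arc set `F`, in which `a ∈ F` is an arc from `tail a` to `head a`,
the sequence of arcs `p` leads from `s` to `u`. -/
def IsDipath {V A : Type*} (F : Finset A) (tail head : A → V) : V → List A → V → Prop
  | s, [], u => s = u
  | s, a :: p, u => a ∈ F ∧ tail a = s ∧ IsDipath F tail head (head a) p u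

/-- The digraph `(U, F)`, in which `a ∈ F` is an arc from `tail a` to `head a`, is an
`S`-branching: `S ⊆ U` and every `u ∈ U` is reached from `S` in exactly one way (by one starting
vertex in `S` and one sequence of arcs). Repeated vertices are not excluded in advance: it is the
uniqueness that forces all these sequences to be paths, and that rules out arcs entering a root
or closing a directed cycle. -/
def IsBranching {V A : Type*} (U : Finset V) (F : Finset A) (tail head : A → V)
    (S : Finset V) : Prop :=
  (∀ a ∈ F, tail a ∈ U ∧ head a ∈ U) ∧ S ⊆ U ∧
    ∀ u ∈ U, ∃! p : V × List A, p.1 ∈ S ∧ IsDipath F tail head p.1 p.2 u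

namespace Dypergraph

variable {V A : Type*} [DecidableEq V]

/-- The in-degree of a vertex: the number of hyperarcs with head `v`. -/
def inDegree (B : Dypergraph V A) (v : V) : ℕ :=
  (B.arcs.filter fun a => B.head a = v).card

/-- The core with respect to `S`: the vertices of in-degree at least `1` together with `S`. -/
def core (B : Dypergraph V A) (S : Finset V) : Finset V :=
  (B.verts.filter fun v => 1 ≤ B.inDegree v) ∪ S

/-- `S`-hyperbranching: every hyperarc can be trimmed to an arc from one of its tails to its head
such that the core together with these arcs is an `S`-branching. -/
def IsHyperbranching (B : Dypergraph V A) (S : Finset V) : Prop :=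
  S ⊆ B.verts ∧ ∃ tail : A → V, (∀ a ∈ B.arcs, tail a ∈ B.tails a) ∧
    IsBranching (B.core S) B.arcs tail B.head S

end Dypergraph

namespace MultiHypergraph

variable {V E : Type*}

/-- `T` is a subhypergraph of `G`. -/
def IsSubhypergraph (T G : MultiHypergraph V E) : Prop :=
  T.verts ⊆ G.verts ∧ T.edges ⊆ G.edges ∧ ∀ e ∈ T.edges, T.ends e = G.ends e

variable [DecidableEq V]

/-- `B` arises from `T` by orienting every hyperedge, that is, by choosing one of its vertices
as head, the other ones being the tails. -/
def IsOrientation (T : MultiHypergraph V E) (B : Dypergraph V E) : Prop :=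
  B.verts = T.verts ∧ B.arcs = T.edges ∧
    ∀ e ∈ T.edges, B.head e ∈ T.ends e ∧ B.tails e = (T.ends e).erase (B.head e)

/-- `T` is a spanning `S`-hyperforest in `G`: a subhypergraph that can be oriented to an
`S`-hyperbranching whose core is the whole vertex set of `G`. -/
def IsSpanningHyperforest (G T : MultiHypergraph V E) (S : Finset V) : Prop :=
  T.IsSubhypergraph G ∧ ∃ B : Dypergraph V E, T.IsOrientation B ∧ B.IsHyperbranching S ∧
    B.core S = G.verts

/-- The family `B` of `k` hypergraphs with the family `S` of root sets is a packing of `k`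
spanning `S i`-hyperforests `B i` in `G`. -/
def IsSpanningPacking (G : MultiHypergraph V E) {k : ℕ} (B : Fin k → MultiHypergraph V E)
    (S : Fin k → Finset V) : Prop :=
  (∀ i, G.IsSpanningHyperforest (B i) (S i)) ∧
    ∀ i j, i ≠ j → Disjoint (B i).edges (B j).edges

/-- The hyperedge `e` enters `X`: it has a vertex in `X` and a vertex outside `X`. -/
def Enters (G : MultiHypergraph V E) (e : E) (X : Finset V) : Prop :=
  (G.ends e ∩ X).Nonempty ∧ (G.ends e \ X).Nonempty

open Classical in
/-- The number of hyperedges that enter some member of the partition `P` of the vertex set. -/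
noncomputable def enteringCount (G : MultiHypergraph V E) (P : Finpartition G.verts) : ℕ :=
  (G.edges.filter fun e => ∃ X ∈ P.parts, G.Enters e X).card

end MultiHypergraph

/-- For `m` on `{0, 1, …, k}`, the sum `m(K)` over `K = {1, …, k}`. -/
def sumK {k : ℕ} (m : Fin (k + 1) → ℕ) : ℕ := ∑ i : Fin k, m i.succ

/-- The function `m_p`, with `m_p(i) = min {m(i), p}`. -/
def truncAt {k : ℕ} (m : Fin (k + 1) → ℕ) (p : ℕ) : Fin (k + 1) → ℕ := fun i => min (m i) p

/-! Necessity is a count. A spanning hyperforest with root set `S` contains, for every part of `P`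
that misses `S`, a hyperedge entering that part with its head there. These hyperedges are distinct,
and at most `min |P| |S|` parts meet `S`. Summing over the disjoint hyperforests and bounding the
root numbers gives both inequalities.

Sufficiency is a matroid argument. A hyperedge `e` trimmed to a pair `uv` and given colour `i` is an
element `(e, i, u, v)`; let `r i` be the cycle-matroid rank of the elements of colour `i`. A forest
with root set `S` has `|V| - |S|` edges, so the task is to use each hyperedge at most once while
finding forests of sizes `d i ∈ [a i, b i]` with total `t`. Suitable `d i` exist once `∑ min (r i)
(b i) ≥ t` and `∑ min (r i) (a i) ≥ ∑ a i`. After a shift, both say that the minimum of two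
submodular functions is at least `t`, and this minimum is again submodular, so Rado's theorem
(`IsSubmodular.exists_transversal`) applies. Its condition for a hyperedge set `J` follows from the
hypothesis for the partition into components of `J`: the rank is at least `|V| - |P|`, and only
hyperedges outside `J` enter parts. -/

open Finset

/-! ### Submodular functions and Rado's theorem -/

/-- A set function on finite sets is submodular. -/
def IsSubmodular {α : Type*} [DecidableEq α] (f : Finset α → ℤ) : Prop :=
  ∀ X Y, f (X ∪ Y) + f (X ∩ Y) ≤ f X + f Y

section Submodular

variable {α : Type*} [DecidableEq α]

/-- The minimum of two submodular functions whose difference is monotone is submodular. -/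
protected theorem IsSubmodular.min {f g : Finset α → ℤ} (hf : IsSubmodular f) (hg : IsSubmodular g)
    (h : Monotone fun X => f X - g X) : IsSubmodular fun X => min (f X) (g X) := by
  intro X Y
  have h1 := hf X Y
  have h2 := hg X Y
  -- The mixed case uses this: `f X + g Y ≥ g (X ∪ Y) + f (X ∩ Y)`, because `f - g` does not
  -- decrease from `Y` to `X ∪ Y`.
  have h3 : f X - g X ≤ f (X ∪ Y) - g (X ∪ Y) := h subset_union_left
  have h4 : f Y - g Y ≤ f (X ∪ Y) - g (X ∪ Y) := h subset_union_right
  simp only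
  omega

theorem IsSubmodular.min_const {f : Finset α → ℤ} (hf : IsSubmodular f) (hm : Monotone f) (c : ℤ) :
    IsSubmodular fun X => Min.min (f X) c :=
  hf.min (fun _ _ => le_rfl) fun _ _ hXY => sub_le_sub_right (hm hXY) c

theorem IsSubmodular.add_const {f : Finset α → ℤ} (hf : IsSubmodular f) (c : ℤ) :
    IsSubmodular fun X => f X + c := by
  intro X Y
  have := hf X Y
  simp only
  omega

theorem IsSubmodular.sum {ι : Type*} (s : Finset ι) {f : ι → Finset α → ℤ}
    (hf : ∀ i ∈ s, IsSubmodular (f i)) : IsSubmodular fun X => ∑ i ∈ s, f i X := by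
  intro X Y
  simp only [← sum_add_distrib]
  exact sum_le_sum fun i hi => hf i hi X Y

theorem IsSubmodular.filter {f : Finset α → ℤ} (hf : IsSubmodular f) (p : α → Prop)
    [DecidablePred p] : IsSubmodular fun X => f (X.filter p) := by
  intro X Y
  simp only [filter_union, filter_inter_distrib]
  exact hf _ _

/-- **Rado's theorem** with deficiency, for monotone submodular functions: if the fibres of `π`
over every set `J` of indices have large value, then there is a partial transversal of large
value. -/
theorem IsSubmodular.exists_transversal {E : Type*} [DecidableEq E] {f : Finset α → ℤ}
    (hf : IsSubmodular f) (hm : Monotone f) (π : α → E) (I : Finset E) (d : ℤ) (X : Finset α)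
    (hX : ∀ J ⊆ I, (J.card : ℤ) ≤ f (X.filter fun x => π x ∈ J) + d) (hXI : ∀ x ∈ X, π x ∈ I) :
    ∃ Y ⊆ X, Set.InjOn π Y ∧ (I.card : ℤ) ≤ f Y + d := by
  induction X using Finset.strongInduction with
  | H X ih =>
    by_cases hinj : Set.InjOn π X
    · refine ⟨X, Subset.rfl, hinj, ?_⟩
      have := hX I Subset.rfl
      rwa [filter_true_of_mem hXI] at this
    -- Of two elements in one fibre, one can be deleted. Otherwise violating sets `J₁`, `J₂` both
    -- contain that index, and submodularity loses only 1 on `J₁ ∩ J₂` against a total violation of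
    -- 2.
    · have hstep : ∃ z ∈ X, ∀ J ⊆ I,
          (J.card : ℤ) ≤ f ((X.erase z).filter fun x => π x ∈ J) + d := by
        by_contra! hcon
        obtain ⟨x, hx, y, hy, hxy, hne⟩ : ∃ x ∈ X, ∃ y ∈ X, π x = π y ∧ x ≠ y := by
          simpa [Set.InjOn] using hinj
        obtain ⟨J₁, hJ₁, h₁⟩ := hcon x hx
        obtain ⟨J₂, hJ₂, h₂⟩ := hcon y hy
        have hmem₁ : π x ∈ J₁ := by
          by_contra hn
          have h := hX J₁ hJ₁
          have : (X.erase x).filter (fun z => π z ∈ J₁) = X.filter fun z => π z ∈ J₁ := by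
            grind
          rw [this] at h₁
          omega
        have hmem₂ : π x ∈ J₂ := by
          by_contra hn
          have h := hX J₂ hJ₂
          have : (X.erase y).filter (fun z => π z ∈ J₂) = X.filter fun z => π z ∈ J₂ := by
            grind
          rw [this] at h₂
          omega
        have hsub := hf ((X.erase x).filter fun z => π z ∈ J₁) ((X.erase y).filter fun z => π z ∈ J₂)
        have hu : X.filter (fun z => π z ∈ J₁ ∪ J₂) ⊆
            ((X.erase x).filter fun z => π z ∈ J₁) ∪ ((X.erase y).filter fun z => π z ∈ J₂) := by
          intro z hz
          grind
        have hi : X.filter (fun z => π z ∈ (J₁ ∩ J₂).erase (π x)) ⊆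
            ((X.erase x).filter fun z => π z ∈ J₁) ∩ ((X.erase y).filter fun z => π z ∈ J₂) := by
          intro z hz
          grind
        have hu' := hX (J₁ ∪ J₂) (union_subset hJ₁ hJ₂)
        have hi' := hX ((J₁ ∩ J₂).erase (π x))
          ((erase_subset _ _).trans (inter_subset_left.trans hJ₁))
        have hc := card_union_add_card_inter J₁ J₂
        have hc' := card_erase_add_one (mem_inter.2 ⟨hmem₁, hmem₂⟩)
        have := hm hu
        have := hm hi
        omega
      obtain ⟨z, hz, hJ⟩ := hstep
      obtain ⟨Y, hY, h⟩ := ih _ (erase_ssubset hz) hJ fun x hx => hXI x (mem_of_mem_erase hx)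
      exact ⟨Y, hY.trans (erase_subset _ _), h⟩

end Submodular

/-- Integers between given bounds can be chosen with a prescribed sum. -/
theorem exists_between_sum_eq {ι : Type*} (s : Finset ι) (a c : ι → ℤ) (t : ℤ)
    (hac : ∀ i ∈ s, a i ≤ c i) (ha : ∑ i ∈ s, a i ≤ t) (hc : t ≤ ∑ i ∈ s, c i) :
    ∃ d : ι → ℤ, (∀ i ∈ s, a i ≤ d i ∧ d i ≤ c i) ∧ ∑ i ∈ s, d i = t := by
  classical
  induction s using Finset.induction_on generalizing t with
  | empty => exact ⟨a, by simp, by simp_all; omega⟩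
  | insert j s hj ih =>
    rw [sum_insert hj] at ha hc
    have hs : ∑ i ∈ s, a i ≤ ∑ i ∈ s, c i :=
      sum_le_sum fun i hi => hac i (mem_insert_of_mem hi)
    have hjac := hac j (mem_insert_self _ _)
    -- The least value at `j` whose remainder does not exceed the upper bounds on `s`.
    obtain ⟨d, hd, hsum⟩ := ih (t - max (a j) (t - ∑ i ∈ s, c i))
      (fun i hi => hac i (mem_insert_of_mem hi)) (by omega) (by omega)
    refine ⟨Function.update d j (max (a j) (t - ∑ i ∈ s, c i)), ?_, ?_⟩
    · intro i hi
      by_cases hij : i = j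
      · subst hij
        simp only [Function.update_self]
        omega
      · simpa [Function.update_of_ne hij] using hd i (mem_of_mem_insert_of_ne hi hij)
    · rw [sum_insert hj, Function.update_self, sum_update_of_notMem hj, hsum]
      omega

/-! ### Rank and forests in the cycle matroid -/

section GraphicRank

variable {α W : Type*}

/-- The rational functions on the vertices of a graph that are constant along the edges in `X`,
where `x` joins `p x` to `q x`. -/
def edgeConstant (p q : α → W) (X : Finset α) : Submodule ℚ (W → ℚ) where
  carrier := {g | ∀ x ∈ X, g (p x) = g (q x)}
  add_mem' ha hb x hx := by simp [ha x hx, hb x hx]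
  zero_mem' := by simp
  smul_mem' c g hg x hx := by simp [hg x hx]

variable [Fintype W]

/-- The rank of an edge set `X` in the cycle matroid of a graph, where `x` joins `p x` to `q x`. -/
noncomputable def graphicRank (p q : α → W) (X : Finset α) : ℤ :=
  Fintype.card W - Module.finrank ℚ (edgeConstant p q X)

theorem graphicRank_mono (p q : α → W) : Monotone (graphicRank p q) := by
  intro X Y hXY
  have : Module.finrank ℚ (edgeConstant p q Y) ≤ Module.finrank ℚ (edgeConstant p q X) :=
    Submodule.finrank_mono fun g hg x hx => hg x (hXY hx)
  unfold graphicRank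
  omega

/-- This is the dimension formula: for the spaces of edge-constant functions, the intersection for
`X` and `Y` lies in the space for `X ∪ Y`, and the sum lies in the space for `X ∩ Y`. -/
theorem graphicRank_submodular [DecidableEq α] (p q : α → W) : IsSubmodular (graphicRank p q) := by
  intro X Y
  have h := Submodule.finrank_sup_add_finrank_inf_eq (edgeConstant p q X) (edgeConstant p q Y)
  have h1 : Module.finrank ℚ ↥(edgeConstant p q X ⊔ edgeConstant p q Y) ≤
      Module.finrank ℚ (edgeConstant p q (X ∩ Y)) :=
    Submodule.finrank_mono <| sup_le (fun g hg x hx => hg x (mem_of_mem_inter_left hx))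
      fun g hg x hx => hg x (mem_of_mem_inter_right hx)
  have h2 : Module.finrank ℚ ↥(edgeConstant p q X ⊓ edgeConstant p q Y) ≤
      Module.finrank ℚ (edgeConstant p q (X ∪ Y)) :=
    Submodule.finrank_mono fun g hg x hx =>
      (mem_union.1 hx).elim (fun h => hg.1 x h) fun h => hg.2 x h
  unfold graphicRank
  omega

/-- If some set `R` of vertices meets every class of vertices connected by `X`, then the rank
of `X` is at least the number of the other vertices. -/
theorem card_sub_card_le_graphicRank (p q : α → W) (X : Finset α) {R : Type*} [Fintype R]
    (ρ : R → W) (h : ∀ g ∈ edgeConstant p q X, (∀ r, g (ρ r) = 0) → g = 0) :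
    (Fintype.card W : ℤ) - Fintype.card R ≤ graphicRank p q X := by
  have : Module.finrank ℚ (edgeConstant p q X) ≤ Module.finrank ℚ (R → ℚ) := by
    refine LinearMap.finrank_le_finrank_of_injective
      (f := (LinearMap.funLeft ℚ ℚ ρ).comp (edgeConstant p q X).subtype) ?_
    rw [injective_iff_map_eq_zero]
    intro g hg
    exact Subtype.ext (h g g.2 fun r => congrFun hg r)
  rw [Module.finrank_fintype_fun_eq_card] at this
  unfold graphicRank
  omega

/-- An edge set contains oriented forests of every size up to its rank; the height `h` increases
along the arcs. -/
theorem exists_forest (p q : α → W) (X : Finset α) (d : ℕ) (hd : (d : ℤ) ≤ graphicRank p q X) :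
    ∃ F ⊆ X, ∃ (tail head : α → W) (h : W → ℕ), F.card = d ∧ Set.InjOn head F ∧
      ∀ x ∈ F, h (tail x) < h (head x) ∧
        ((p x = tail x ∧ q x = head x) ∨ (p x = head x ∧ q x = tail x)) := by
  classical
  let H : SimpleGraph W := SimpleGraph.fromRel fun u v => ∃ x ∈ X, p x = u ∧ q x = v
  let root : W → W := fun v => (H.connectedComponentMk v).out
  have hroot : ∀ v, H.Reachable v (root v) := fun v =>
    SimpleGraph.ConnectedComponent.exact (Quot.out_eq _).symm
  -- Functions on the components pull back injectively to edge-constant functions.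
  have hcard : Fintype.card H.ConnectedComponent ≤ Module.finrank ℚ (edgeConstant p q X) := by
    rw [← Module.finrank_fintype_fun_eq_card (R := ℚ)]
    have hmem : ∀ g : H.ConnectedComponent → ℚ,
        LinearMap.funLeft ℚ ℚ H.connectedComponentMk g ∈ edgeConstant p q X := by
      intro g x hx
      by_cases hpq : p x = q x
      · rw [hpq]
      · refine congrArg g (SimpleGraph.ConnectedComponent.sound (SimpleGraph.Adj.reachable ?_))
        exact ⟨hpq, Or.inl ⟨x, hx, rfl, rfl⟩⟩
    refine LinearMap.finrank_le_finrank_of_injective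
      (f := (LinearMap.funLeft ℚ ℚ H.connectedComponentMk).codRestrict _ hmem) ?_
    intro g g' hgg
    have := congrArg Subtype.val hgg
    exact LinearMap.funLeft_injective_of_surjective ℚ ℚ _ Quot.mk_surjective this
  let R : Finset W := univ.image fun c : H.ConnectedComponent => c.out
  have hR : R.card ≤ Fintype.card H.ConnectedComponent := card_image_le
  -- The first edge of a shortest path to the representative of the component reduces the distance.
  have hstep : ∀ v ∉ R, ∃ x ∈ X, ∃ u, H.dist u (root u) < H.dist v (root v) ∧
      ((p x = u ∧ q x = v) ∨ (p x = v ∧ q x = u)) := by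
    intro v hv
    have hne : v ≠ root v := fun h => hv (mem_image.2 ⟨_, mem_univ _, h.symm⟩)
    obtain ⟨w, hw⟩ := (hroot v).exists_walk_length_eq_dist
    generalize hrv : root v = r at w hw hne
    cases w with
    | nil => exact absurd rfl hne
    | @cons _ u _ huv w =>
      have hru : root u = r := by
        rw [← hrv]
        change (H.connectedComponentMk u).out = (H.connectedComponentMk v).out
        rw [SimpleGraph.ConnectedComponent.sound huv.reachable]
      have hlt : H.dist u (root u) < H.dist v r := by
        have := SimpleGraph.dist_le w
        rw [hru, ← hw, SimpleGraph.Walk.length_cons]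
        omega
      obtain ⟨-, ⟨x, hx, hp, hq⟩ | ⟨x, hx, hp, hq⟩⟩ := huv
      · exact ⟨x, hx, u, hlt, Or.inr ⟨hp, hq⟩⟩
      · exact ⟨x, hx, u, hlt, Or.inl ⟨hp, hq⟩⟩
  have hNcard : d ≤ (univ \ R).card := by
    rw [card_sdiff_of_subset (subset_univ _), card_univ]
    unfold graphicRank at hd
    omega
  -- Any `d` non-representatives serve as heads; the others become further roots.
  obtain ⟨N, hN, hNd⟩ := exists_subset_card_eq hNcard
  choose e he u hu hpq using fun v : N => hstep v (mem_sdiff.1 (hN v.2)).2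
  let h : W → ℕ := fun v => H.dist v (root v)
  have hhead : ∀ v : N, (if h (p (e v)) < h (q (e v)) then q (e v) else p (e v)) = v := by
    intro v
    have huv : h (u v) < h v := hu v
    rcases hpq v with ⟨h1, h2⟩ | ⟨h1, h2⟩ <;> rw [h1, h2]
    · exact if_pos huv
    · exact if_neg huv.not_gt
  have hinj : Function.Injective e := fun v w hvw =>
    Subtype.ext <| by rw [← hhead v, ← hhead w, hvw]
  refine ⟨univ.image e, ?_, fun x => if h (p x) < h (q x) then p x else q x,
    fun x => if h (p x) < h (q x) then q x else p x, h, ?_, ?_, ?_⟩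
  · simpa [image_subset_iff] using fun v hv => he ⟨v, hv⟩
  · rw [card_image_of_injective _ hinj, card_univ, Fintype.card_coe, hNd]
  · simp only [coe_image, coe_univ, Set.image_univ]
    rintro _ ⟨v, rfl⟩ _ ⟨w, rfl⟩ hvw
    simp only [hhead] at hvw
    rw [Subtype.ext hvw]
  · intro x hx
    obtain ⟨v, -, rfl⟩ := mem_image.1 hx
    have huv : h (u v) < h v := hu v
    rcases hpq v with ⟨h1, h2⟩ | ⟨h1, h2⟩ <;> simp [h1, h2, huv, huv.not_gt]

end GraphicRank

/-! ### Branchings from height functions -/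

section Branching

variable {V A : Type*} {F : Finset A} {tail head : A → V}

theorem isDipath_append_singleton {s u : V} {p : List A} {a : A} :
    IsDipath F tail head s (p ++ [a]) u ↔
      IsDipath F tail head s p (tail a) ∧ a ∈ F ∧ head a = u := by
  induction p generalizing s with
  | nil =>
    simp only [List.nil_append, IsDipath]
    grind
  | cons b p ih =>
    simp only [List.cons_append, IsDipath, ih]
    tauto

/-- A directed path entering a set of vertices has an arc entering this set. -/
theorem IsDipath.exists_entering {X : Finset V} {s u : V} {p : List A}
    (h : IsDipath F tail head s p u) (hs : s ∉ X) (hu : u ∈ X) :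
    ∃ a ∈ F, tail a ∉ X ∧ head a ∈ X := by
  induction p generalizing s with
  | nil => exact absurd (h ▸ hu) hs
  | cons a p ih =>
    obtain ⟨ha, rfl, hp⟩ := h
    by_cases hX : head a ∈ X
    · exact ⟨a, ha, hs, hX⟩
    · exact ih hp hX

/-- An arc set with distinct heads along which a height function increases is a branching
rooted at the vertices that are not heads. -/
theorem isBranching_of_height [DecidableEq V] (U : Finset V)
    (hU : ∀ a ∈ F, tail a ∈ U ∧ head a ∈ U) (hinj : Set.InjOn head F) (h : V → ℕ)
    (hh : ∀ a ∈ F, h (tail a) < h (head a)) :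
    IsBranching U F tail head (U \ F.image head) := by
  refine ⟨hU, sdiff_subset, fun u hu => existsUnique_of_exists_of_unique ?_ ?_⟩
  · induction hn : h u using Nat.strong_induction_on generalizing u with
    | _ n ih =>
      by_cases hmem : u ∈ F.image head
      · obtain ⟨a, ha, rfl⟩ := mem_image.1 hmem
        obtain ⟨⟨s, p⟩, hs, hp⟩ := ih _ (hn ▸ hh a ha) (tail a) (hU a ha).1 rfl
        exact ⟨(s, p ++ [a]), hs, isDipath_append_singleton.2 ⟨hp, ha, rfl⟩⟩
      · exact ⟨(u, []), mem_sdiff.2 ⟨hu, hmem⟩, rfl⟩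
  · rintro ⟨s, p⟩ ⟨s', p'⟩ ⟨hs, hp⟩ ⟨hs', hp'⟩
    simp only at hs hp hs' hp'
    -- Paths are compared from their last arc, which is determined by its head; roots are not heads.
    induction p using List.reverseRecOn generalizing u p' with
    | nil =>
      obtain rfl : s = u := hp
      rcases p'.eq_nil_or_concat with rfl | ⟨r, b, rfl⟩
      · obtain rfl : s' = s := hp'
        rfl
      · rw [List.concat_eq_append] at *
        obtain ⟨-, hb, rfl⟩ := isDipath_append_singleton.1 hp'
        exact absurd (mem_image_of_mem head hb) (mem_sdiff.1 hs).2
    | append_singleton r a ih =>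
      obtain ⟨hr, ha, rfl⟩ := isDipath_append_singleton.1 hp
      rcases p'.eq_nil_or_concat with rfl | ⟨r', b, rfl⟩
      · obtain rfl : s' = head a := hp'
        exact absurd (mem_image_of_mem head ha) (mem_sdiff.1 hs').2
      · rw [List.concat_eq_append] at *
        obtain ⟨hr', hb, hba⟩ := isDipath_append_singleton.1 hp'
        obtain rfl := hinj hb ha hba
        have := ih (tail b) (hU b hb).1 r' hr hr'
        simp_all

end Branching

/-! ### Necessity for a single hyperforest -/

namespace MultiHypergraph

variable {V E : Type*} [DecidableEq V]

open Classical in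
/-- Every member of a partition avoiding the roots is entered by its own hyperedge of a
spanning hyperforest. -/
theorem IsSpanningHyperforest.card_parts_le {G T : MultiHypergraph V E} {S : Finset V}
    (h : G.IsSpanningHyperforest T S) (P : Finpartition G.verts) :
    P.parts.card ≤ min P.parts.card S.card +
      (T.edges.filter fun e => ∃ X ∈ P.parts, G.Enters e X).card := by
  obtain ⟨⟨-, -, hends⟩, B, ⟨-, harcs, hor⟩, ⟨-, tail, htail, hbr⟩, hcore⟩ := h
  obtain ⟨-, -, hbr⟩ := hbr
  rw [hcore] at hbr
  have h1 : (P.parts.filter fun X => (X ∩ S).Nonempty).card ≤ S.card := by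
    refine card_le_card_of_forall_subsingleton (fun X v => v ∈ X) (fun X hX => ?_) fun v _ => ?_
    · obtain ⟨v, hv⟩ := (mem_filter.1 hX).2
      exact ⟨v, mem_of_mem_inter_right hv, mem_of_mem_inter_left hv⟩
    · rintro X ⟨hX, hvX⟩ Y ⟨hY, hvY⟩
      exact P.eq_of_mem_parts (mem_filter.1 hX).1 (mem_filter.1 hY).1 hvX hvY
  have hent : ∀ X ∈ P.parts.filter (fun X => ¬ (X ∩ S).Nonempty),
      ∃ a ∈ T.edges, G.Enters a X ∧ B.head a ∈ X := by
    intro X hX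
    obtain ⟨hX, hXS⟩ := mem_filter.1 hX
    obtain ⟨u, hu⟩ := P.nonempty_of_mem_parts hX
    obtain ⟨⟨s, p⟩, ⟨hs, hp⟩, -⟩ := hbr u (P.le hX hu)
    obtain ⟨a, ha, hta, hha⟩ :=
      hp.exists_entering (fun hsX => hXS ⟨s, mem_inter.2 ⟨hsX, hs⟩⟩) hu
    have haT : a ∈ T.edges := harcs ▸ ha
    have htl := htail a ha
    rw [(hor a haT).2, hends a haT] at htl
    have hhd := (hor a haT).1
    rw [hends a haT] at hhd
    exact ⟨a, haT, ⟨⟨_, mem_inter.2 ⟨hhd, hha⟩⟩,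
      ⟨_, mem_sdiff.2 ⟨mem_of_mem_erase htl, hta⟩⟩⟩, hha⟩
  have h2 : (P.parts.filter fun X => ¬ (X ∩ S).Nonempty).card ≤
      (T.edges.filter fun e => ∃ X ∈ P.parts, G.Enters e X).card := by
    refine card_le_card_of_forall_subsingleton (fun X a => B.head a ∈ X) (fun X hX => ?_)
      fun a _ => ?_
    · obtain ⟨a, ha, haX, hhead⟩ := hent X hX
      exact ⟨a, mem_filter.2 ⟨ha, X, (mem_filter.1 hX).1, haX⟩, hhead⟩
    · rintro X ⟨hX, hvX⟩ Y ⟨hY, hvY⟩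
      exact P.eq_of_mem_parts (mem_filter.1 hX).1 (mem_filter.1 hY).1 hvX hvY
  have h3 := card_filter_add_card_filter_not (s := P.parts) fun X => (X ∩ S).Nonempty
  omega

end MultiHypergraph

/-! ### Transversals with bounds on several ranks -/

/-- A common transversal version of Rado's theorem for several monotone submodular functions
`r i`, with bounds `a i` and `b i` on the part of the `i`-th function in the total `t`. -/
theorem exists_transversal_between {α E ι : Type*} [DecidableEq α] [DecidableEq E] [Fintype ι]
    (r : ι → Finset α → ℤ) (hr : ∀ i, IsSubmodular (r i)) (hm : ∀ i, Monotone (r i))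
    (a b : ι → ℤ) (hab : ∀ i, a i ≤ b i) (t : ℤ) (ht : ∑ i, a i ≤ t)
    (π : α → E) (I : Finset E) (X : Finset α) (hXI : ∀ x ∈ X, π x ∈ I)
    (h₁ : ∀ J ⊆ I, t ≤ (I \ J).card + ∑ i, min (r i (X.filter fun x => π x ∈ J)) (b i))
    (h₂ : ∀ J ⊆ I,
      ∑ i, a i ≤ (I \ J).card + ∑ i, min (r i (X.filter fun x => π x ∈ J)) (a i)) :
    ∃ Y ⊆ X, Set.InjOn π Y ∧ ∃ d : ι → ℤ,
      (∀ i, a i ≤ d i ∧ d i ≤ b i ∧ d i ≤ r i Y) ∧ ∑ i, d i = t := by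
  have hf₁ : IsSubmodular fun Y => ∑ i, min (r i Y) (b i) :=
    IsSubmodular.sum _ fun i _ => (hr i).min_const (hm i) _
  have hf₂ : IsSubmodular fun Y => (∑ i, min (r i Y) (a i)) + (t - ∑ i, a i) :=
    (IsSubmodular.sum _ fun i _ => (hr i).min_const (hm i) _).add_const _
  have hm₁ : Monotone fun Y => ∑ i, min (r i Y) (b i) := fun Y Z hYZ =>
    sum_le_sum fun i _ => min_le_min_right _ (hm i hYZ)
  have hm₂ : Monotone fun Y => (∑ i, min (r i Y) (a i)) + (t - ∑ i, a i) := fun Y Z hYZ =>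
    add_le_add_left (sum_le_sum fun i _ => min_le_min_right _ (hm i hYZ)) _
  -- As `a i ≤ b i`, the difference `min r b - min r a` is `r` clamped to `[a, b]`, minus `a`.
  have hdiff : Monotone fun Y =>
      (∑ i, min (r i Y) (b i)) - ((∑ i, min (r i Y) (a i)) + (t - ∑ i, a i)) := by
    intro Y Z hYZ
    have : ∑ i, (min (r i Y) (b i) - min (r i Y) (a i)) ≤
        ∑ i, (min (r i Z) (b i) - min (r i Z) (a i)) := by
      refine sum_le_sum fun i _ => ?_
      have h1 : r i Y ≤ r i Z := hm i hYZ
      have h2 := hab i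
      omega
    simp only [sum_sub_distrib] at this
    simp only
    omega
  -- Deficiency `|I| - t` turns Rado's conclusion into the value bound `t`.
  obtain ⟨Y, hYX, hinj, hY⟩ := (hf₁.min hf₂ hdiff).exists_transversal (hm₁.min hm₂) π I (I.card - t)
    X (fun J hJ => by
      have h1 := h₁ J hJ
      have h2 := h₂ J hJ
      have h3 := card_sdiff_add_card_eq_card hJ
      omega) hXI
  have hYb : t ≤ ∑ i, min (r i Y) (b i) := by omega
  have hYa : ∑ i, a i ≤ ∑ i, min (r i Y) (a i) := by omega
  have hra : ∀ i, a i ≤ r i Y := by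
    have := (sum_eq_sum_iff_of_le fun i (_ : i ∈ univ) => min_le_right (r i Y) (a i)).1
      (le_antisymm (sum_le_sum fun i _ => min_le_right _ _) hYa)
    intro i
    have := this i (mem_univ _)
    omega
  obtain ⟨d, hd, hsum⟩ := exists_between_sum_eq univ a (fun i => min (r i Y) (b i)) t
    (fun i _ => le_min (hra i) (hab i)) ht hYb
  refine ⟨Y, hYX, hinj, d, fun i => ?_, hsum⟩
  have := hd i (mem_univ _)
  omega

/-! ### From transversals to packings -/

namespace MultiHypergraph

variable {V E : Type*} [DecidableEq V]

/-- Hyperedges that are trimmed to arcs with distinct heads along which a height function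
increases form a spanning hyperforest rooted at the vertices that are not heads. -/
theorem exists_isSpanningHyperforest (G : MultiHypergraph V E) (F : Finset E) (hF : F ⊆ G.edges)
    (tail head : E → V) (h : V → ℕ) (hinj : Set.InjOn head F)
    (hends : ∀ e ∈ F, tail e ∈ G.ends e ∧ head e ∈ G.ends e ∧ h (tail e) < h (head e)) :
    ∃ T : MultiHypergraph V E, T.edges = F ∧
      G.IsSpanningHyperforest T (G.verts \ F.image head) := by
  have hU : ∀ e ∈ F, tail e ∈ G.verts ∧ head e ∈ G.verts := fun e he =>
    ⟨G.ends_subset e (hF he) (hends e he).1, G.ends_subset e (hF he) (hends e he).2.1⟩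
  let T : MultiHypergraph V E :=
    ⟨G.verts, F, G.ends, fun e he => G.ends_subset e (hF he), fun e he => G.two_le_card e (hF he)⟩
  have htail : ∀ e ∈ F, tail e ∈ (G.ends e).erase (head e) := fun e he =>
    mem_erase.2 ⟨fun heq => (hends e he).2.2.ne (congrArg h heq), (hends e he).1⟩
  let B : Dypergraph V E :=
    { verts := G.verts
      arcs := F
      head := head
      tails := fun e => (G.ends e).erase (head e)
      head_mem := fun e he => (hU e he).2
      tails_subset := fun e he => (erase_subset _ _).trans (G.ends_subset e (hF he))
      tails_nonempty := fun e he => ⟨_, htail e he⟩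
      head_notMem_tails := fun e _ => notMem_erase _ _ }
  have hcore : B.core (G.verts \ F.image head) = G.verts := by
    ext v
    have hdeg : 1 ≤ B.inDegree v ↔ v ∈ F.image head := by
      rw [Dypergraph.inDegree, Nat.one_le_iff_ne_zero, ← Nat.pos_iff_ne_zero, card_pos]
      simp only [Finset.Nonempty, mem_filter, mem_image, B]
    rw [Dypergraph.core, mem_union, mem_filter, hdeg, mem_sdiff]
    change v ∈ G.verts ∧ _ ∨ _ ↔ _
    tauto
  refine ⟨T, rfl, ⟨Subset.rfl, hF, fun _ _ => rfl⟩, B,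
    ⟨rfl, rfl, fun e he => ⟨(hends e he).2.1, rfl⟩⟩, ⟨sdiff_subset, tail, htail, ?_⟩, hcore⟩
  rw [hcore]
  exact isBranching_of_height G.verts hU hinj h fun e he => (hends e he).2.2

/-- The partition of the vertex set into the components of the hypergraph with edge set `J`. -/
theorem exists_component_partition (G : MultiHypergraph V E) (J : Finset E)
    (hJ : J ⊆ G.edges) : ∃ P : Finpartition G.verts, (∀ e ∈ J, ∀ X ∈ P.parts, ¬ G.Enters e X) ∧
      ∀ g : V → ℚ, (∀ e ∈ J, ∀ u ∈ G.ends e, ∀ v ∈ G.ends e, g u = g v) →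
        ∀ X ∈ P.parts, ∀ u ∈ X, ∀ v ∈ X, g u = g v := by
  classical
  -- Equivalence means that no test function constant on each hyperedge of `J` separates the two
  -- vertices, which matches the rank defined by edge-constant functions.
  let s : Setoid V :=
    { r := fun u v => ∀ g : V → ℚ,
        (∀ e ∈ J, ∀ u ∈ G.ends e, ∀ v ∈ G.ends e, g u = g v) → g u = g v
      iseqv := ⟨fun _ _ _ => rfl, fun h g hg => (h g hg).symm,
        fun h h' g hg => (h g hg).trans (h' g hg)⟩ }
  have hparts : ∀ X ∈ (Finpartition.ofSetSetoid s G.verts).parts,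
      ∃ a, ∀ b, b ∈ X ↔ b ∈ G.verts ∧ s.r a b := by
    intro X hX
    obtain ⟨a, -, rfl⟩ := mem_image.1 hX
    exact ⟨a, fun b => mem_filter⟩
  refine ⟨Finpartition.ofSetSetoid s G.verts, ?_, ?_⟩
  · rintro e he X hX ⟨⟨u, hu⟩, ⟨v, hv⟩⟩
    obtain ⟨a, ha⟩ := hparts X hX
    rw [mem_inter, ha] at hu
    rw [mem_sdiff] at hv
    exact hv.2 ((ha v).2 ⟨G.ends_subset e (hJ he) hv.1,
      fun g hg => (hu.2.2 g hg).trans (hg e he u hu.1 v hv.1)⟩)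
  · intro g hg X hX u hu v hv
    obtain ⟨a, ha⟩ := hparts X hX
    exact (((ha u).1 hu).2 g hg).symm.trans (((ha v).1 hv).2 g hg)

open Classical in
/-- The pairs of ends of hyperedges in `J` have rank at least `|V| - |P|` in the cycle matroid,
where no hyperedge in `J` enters a member of the partition `P`. -/
theorem exists_partition_card_le_graphicRank (G : MultiHypergraph V E) (J : Finset E)
    (hJ : J ⊆ G.edges) :
    ∃ P : Finpartition G.verts, G.enteringCount P ≤ (G.edges \ J).card ∧
      ∀ (α : Type _) (p q : α → G.verts) (X : Finset α),
        (∀ e ∈ J, ∀ u v : G.verts, u.1 ∈ G.ends e → v.1 ∈ G.ends e → ∃ x ∈ X, p x = u ∧ q x = v) →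
        (G.verts.card : ℤ) - P.parts.card ≤ graphicRank p q X := by
  obtain ⟨P, hP, hconst⟩ := G.exists_component_partition J hJ
  refine ⟨P, card_le_card fun e he => ?_, fun α p q X hX => ?_⟩
  · obtain ⟨heG, X, hX, heX⟩ := mem_filter.1 he
    exact mem_sdiff.2 ⟨heG, fun heJ => hP e heJ X hX heX⟩
  · choose ρ hρ using fun Q : P.parts => P.nonempty_of_mem_parts Q.2
    have := card_sub_card_le_graphicRank p q X
      (fun Q : P.parts => ⟨ρ Q, P.le Q.2 (hρ Q)⟩) fun g hg h0 => by
        ext v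
        obtain ⟨Q, ⟨hQ, hvQ⟩, -⟩ := P.existsUnique_mem v.2
        have h1 := hconst (fun v => if hv : v ∈ G.verts then g ⟨v, hv⟩ else 0)
          (fun e he u hu v hv => by
          have hu' := G.ends_subset e (hJ he) hu
          have hv' := G.ends_subset e (hJ he) hv
          obtain ⟨x, hx, hpx, hqx⟩ := hX e he ⟨u, hu'⟩ ⟨v, hv'⟩ hu hv
          simp only [hu', hv', dif_pos, ← hpx, ← hqx]
          exact hg x hx) Q hQ v hvQ (ρ ⟨Q, hQ⟩) (hρ ⟨Q, hQ⟩)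
        simpa [P.le hQ (hρ ⟨Q, hQ⟩), h0 ⟨Q, hQ⟩] using h1
    simpa using this

end MultiHypergraph

theorem sumK_truncAt {k : ℕ} (m : Fin (k + 1) → ℕ) (p : ℕ) :
    (sumK (truncAt m p) : ℤ) = ∑ i : Fin k, min (m i.succ : ℤ) p := by
  simp [sumK, truncAt]

namespace MultiHypergraph

variable {V E : Type*} [DecidableEq V]

/-- In a packing of spanning hyperforests, every partition satisfies the entering bound. -/
theorem IsSpanningPacking.mul_card_parts_le {G : MultiHypergraph V E} {k : ℕ}
    {B : Fin k → MultiHypergraph V E} {S : Fin k → Finset V} (h : G.IsSpanningPacking B S)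
    (P : Finpartition G.verts) :
    k * P.parts.card ≤ ∑ i, min P.parts.card (S i).card + G.enteringCount P := by
  classical
  have hunion : ∑ i, ((B i).edges.filter fun e => ∃ X ∈ P.parts, G.Enters e X).card ≤
      G.enteringCount P := by
    rw [← card_biUnion fun i _ j _ hij =>
      disjoint_filter_filter (h.2 i j hij)]
    refine card_le_card fun e he => ?_
    obtain ⟨i, -, hi⟩ := mem_biUnion.1 he
    obtain ⟨heB, heX⟩ := mem_filter.1 hi
    exact mem_filter.2 ⟨(h.1 i).1.2.1 heB, heX⟩
  have hsum := sum_le_sum fun i (_ : i ∈ univ) => (h.1 i).card_parts_le P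
  rw [sum_const, card_univ, Fintype.card_fin, smul_eq_mul, sum_add_distrib] at hsum
  omega

/-- Packings of spanning hyperforests with prescribed bounds `a i`, `b i` on the number of
hyperedges of the `i`-th one, and with `t` hyperedges in total. -/
theorem exists_isSpanningPacking (G : MultiHypergraph V E) (hV : G.verts.Nonempty)
    {k : ℕ} (a b : Fin k → ℤ)
    (ha : ∀ i, 0 ≤ a i) (hab : ∀ i, a i ≤ b i) (t : ℤ) (ht : ∑ i, a i ≤ t)
    (h₁ : ∀ P : Finpartition G.verts,
      t ≤ G.enteringCount P + ∑ i, min ((G.verts.card : ℤ) - P.parts.card) (b i))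
    (h₂ : ∀ P : Finpartition G.verts,
      ∑ i, a i ≤ G.enteringCount P + ∑ i, min ((G.verts.card : ℤ) - P.parts.card) (a i)) :
    ∃ (B : Fin k → MultiHypergraph V E) (S : Fin k → Finset V), G.IsSpanningPacking B S ∧
      (∀ i, a i ≤ (G.verts.card : ℤ) - (S i).card ∧ (G.verts.card : ℤ) - (S i).card ≤ b i) ∧
      ∑ i, ((G.verts.card : ℤ) - (S i).card) = t := by
  classical
  -- Pairs with `u = v` are harmless: they impose no condition on edge-constant functions, and the
  -- strict height excludes them from forests.
  let α := E × Fin k × G.verts × G.verts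
  let p : α → G.verts := fun x => x.2.2.1
  let q : α → G.verts := fun x => x.2.2.2
  let X : Finset α := (G.edges ×ˢ univ).filter fun x => (p x).1 ∈ G.ends x.1 ∧ (q x).1 ∈ G.ends x.1
  let r : Fin k → Finset α → ℤ := fun i Y => graphicRank p q (Y.filter fun x => x.2.1 = i)
  have hrank : ∀ J ⊆ G.edges, ∃ P : Finpartition G.verts,
      G.enteringCount P ≤ (G.edges \ J).card ∧
      ∀ i, (G.verts.card : ℤ) - P.parts.card ≤ r i (X.filter fun x => x.1 ∈ J) := by
    intro J hJ
    obtain ⟨P, hP, hPr⟩ := G.exists_partition_card_le_graphicRank J hJ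
    refine ⟨P, hP, fun i => hPr α p q _ fun e he u v hu hv => ⟨(e, i, u, v), ?_, rfl, rfl⟩⟩
    simp only [X, mem_filter]
    exact ⟨⟨⟨mem_product.2 ⟨hJ he, mem_univ _⟩, hu, hv⟩, he⟩, trivial⟩
  obtain ⟨Y, hYX, hinj, d, hd, hsum⟩ := exists_transversal_between r
    (fun i => (graphicRank_submodular p q).filter _)
    (fun i Y Z hYZ => graphicRank_mono p q (filter_subset_filter _ hYZ)) a b hab t ht
    Prod.fst G.edges X (fun x hx => (mem_product.1 (mem_filter.1 hx).1).1)
    (fun J hJ => by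
      obtain ⟨P, hP, hPr⟩ := hrank J hJ
      have h1 := h₁ P
      have h2 := sum_le_sum fun i (_ : i ∈ univ) => min_le_min_right (b i) (hPr i)
      omega)
    (fun J hJ => by
      obtain ⟨P, hP, hPr⟩ := hrank J hJ
      have h1 := h₂ P
      have h2 := sum_le_sum fun i (_ : i ∈ univ) => min_le_min_right (a i) (hPr i)
      omega)
  have hforest : ∀ i, ∃ (T : MultiHypergraph V E) (S : Finset V), G.IsSpanningHyperforest T S ∧
      (G.verts.card : ℤ) - S.card = d i ∧ ∀ e ∈ T.edges, ∃ x ∈ Y, x.1 = e ∧ x.2.1 = i := by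
    intro i
    obtain ⟨F, hF, tail, head, h, hFd, hhead, hFh⟩ := exists_forest p q
      (Y.filter fun x => x.2.1 = i) (d i).toNat (by
        have := hd i
        have := ha i
        simp only [r] at *
        omega)
    have hFY : ∀ x ∈ F, x ∈ Y := fun x hx => (mem_filter.1 (hF hx)).1
    have hFinj : Set.InjOn Prod.fst (F : Set α) := hinj.mono fun x hx => hFY x hx
    obtain ⟨v₀, -⟩ := id hV
    -- Chosen elements have distinct hyperedges, so their data transfers to `E`; `v₀` is a dummy
    -- value.
    let toE (f : α → G.verts) : E → V :=
      Function.extend (fun x : F => x.1.1) (fun x => (f x : V)) fun _ => v₀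
    have hE : ∀ f, ∀ x ∈ F, toE f x.1 = f x := fun f x hx =>
      Function.Injective.extend_apply (f := fun x : F => x.1.1)
        (fun x y hxy => Subtype.ext (hFinj x.2 y.2 hxy)) _ _ ⟨x, hx⟩
    let h' : V → ℕ := fun v => if hv : v ∈ G.verts then h ⟨v, hv⟩ else 0
    have hheads : (F.image Prod.fst).image (toE head) =
        F.image fun x => (head x : V) := by
      rw [image_image]
      exact image_congr fun x hx => hE head x hx
    have hheadV : Set.InjOn (fun x => (head x : V)) (F : Set α) := fun x hx y hy hxy =>
      hhead hx hy (Subtype.ext hxy)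
    obtain ⟨T, hT, hTF⟩ := G.exists_isSpanningHyperforest (F.image Prod.fst)
      (fun e he => by
        obtain ⟨x, hx, rfl⟩ := mem_image.1 he
        exact (mem_product.1 (mem_filter.1 (hYX (hFY x hx))).1).1)
      (toE tail) (toE head) h'
      (by
        intro e he e' he' hee
        obtain ⟨x, hx, rfl⟩ := mem_image.1 he
        obtain ⟨y, hy, rfl⟩ := mem_image.1 he'
        rw [hE head x hx, hE head y hy] at hee
        rw [hheadV hx hy hee])
      (fun e he => by
        obtain ⟨x, hx, rfl⟩ := mem_image.1 he
        have hpq := (mem_filter.1 (hYX (hFY x hx))).2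
        obtain ⟨hlt, hx'⟩ := hFh x hx
        simp only [hE tail x hx, hE head x hx, h', (tail x).2, (head x).2, dif_pos]
        refine and_assoc.1 ⟨?_, hlt⟩
        rcases hx' with ⟨h1, h2⟩ | ⟨h1, h2⟩ <;> rw [← h1, ← h2]
        · exact hpq
        · exact hpq.symm)
    refine ⟨T, _, hTF, ?_, ?_⟩
    · rw [hheads]
      have hsub : F.image (fun x => (head x : V)) ⊆ G.verts :=
        image_subset_iff.2 fun x _ => (head x).2
      have h1 := card_sdiff_add_card_eq_card hsub
      rw [card_image_of_injOn hheadV] at h1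
      have := hd i
      have := ha i
      omega
    · intro e he
      obtain ⟨x, hx, rfl⟩ := mem_image.1 (hT ▸ he)
      exact ⟨x, hFY x hx, rfl, (mem_filter.1 (hF hx)).2⟩
  choose T S hTS hcard hT using hforest
  refine ⟨T, S, ⟨hTS, fun i j hij => disjoint_left.2 fun e hei hej => hij ?_⟩, fun i => ?_, ?_⟩
  · obtain ⟨x, hx, hxe, rfl⟩ := hT i e hei
    obtain ⟨y, hy, hye, rfl⟩ := hT j e hej
    rw [hinj hx hy (hxe.trans hye.symm)]
  · rw [hcard]
    exact ⟨(hd i).1, (hd i).2.1⟩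
  · simpa only [hcard] using hsum

end MultiHypergraph

/-! ### The characterization -/

theorem mainTheorem6 {V E : Type*} [DecidableEq V] (G : MultiHypergraph V E)
    (k : ℕ) (hk : 0 < k) (ℓ ℓ' : Fin (k + 1) → ℕ)
    (hpos : ∀ i, 0 < ℓ i) (hpos' : ∀ i, 0 < ℓ' i)
    (htotal : ℓ' 0 ≤ sumK ℓ' ∧ ℓ 0 ≤ ℓ' 0 ∧ sumK ℓ ≤ ℓ 0)
    (heach : ∀ i : Fin k, ℓ' i.succ ≤ G.verts.card ∧ ℓ i.succ ≤ ℓ' i.succ) :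
    (∃ (B : Fin k → MultiHypergraph V E) (S : Fin k → Finset V),
      G.IsSpanningPacking B S ∧
      (∀ i : Fin k, ℓ i.succ ≤ (S i).card ∧ (S i).card ≤ ℓ' i.succ) ∧
      ℓ 0 ≤ ∑ i, (S i).card ∧ ∑ i, (S i).card ≤ ℓ' 0) ↔
    ((∀ P : Finpartition G.verts,
        (k : ℤ) * P.parts.card ≤
          (ℓ' 0 : ℤ) - sumK ℓ + sumK (truncAt ℓ P.parts.card) + G.enteringCount P) ∧
      ∀ P : Finpartition G.verts,
        (k : ℤ) * P.parts.card ≤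
          (sumK (truncAt ℓ' P.parts.card) : ℤ) + G.enteringCount P) := by
  have hsumK : ∀ m : Fin (k + 1) → ℕ, (sumK m : ℤ) = ∑ i : Fin k, (m i.succ : ℤ) := fun m => by
    simp [sumK]
  have hconst : ∀ c : ℤ, ∑ _i : Fin k, c = k * c := fun c => by simp
  simp only [sumK_truncAt]
  simp only [hsumK]
  constructor
  · rintro ⟨B, S, hBS, hS, -, hS'⟩
    have key : ∀ P : Finpartition G.verts, (k : ℤ) * P.parts.card ≤
        ∑ i, min (P.parts.card : ℤ) (S i).card + G.enteringCount P := fun P => by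
      exact_mod_cast hBS.mul_card_parts_le P
    refine ⟨fun P => (key P).trans ?_, fun P => (key P).trans ?_⟩
    -- Since `|S i| ≥ ℓ i`, raising `ℓ i` to `|S i|` raises the truncated value by at most `|S i| -
    -- ℓ i`.
    · have h1 : ∑ i, min (P.parts.card : ℤ) (S i).card ≤
          ∑ i, (((S i).card : ℤ) - ℓ i.succ + min (ℓ i.succ : ℤ) P.parts.card) :=
        sum_le_sum fun i _ => by
          have := hS i
          omega
      have h2 : (∑ i, ((S i).card : ℤ)) ≤ ℓ' 0 := by exact_mod_cast hS'
      rw [sum_add_distrib, sum_sub_distrib] at h1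
      omega
    · have h1 : ∑ i, min (P.parts.card : ℤ) (S i).card ≤
          ∑ i : Fin k, min (ℓ' i.succ : ℤ) P.parts.card :=
        sum_le_sum fun i _ => by
          have := hS i
          omega
      omega
  · rintro ⟨h₁, h₂⟩
    have hV : G.verts.Nonempty :=
      card_pos.1 ((hpos' (Fin.succ ⟨0, hk⟩)).trans_le (heach ⟨0, hk⟩).1)
    have htotal' : (ℓ' 0 : ℤ) ≤ ∑ i : Fin k, (ℓ' i.succ : ℤ) := by
      rw [← hsumK]
      exact_mod_cast htotal.1
    -- Termwise, `min (n - c) (n - m) = n - c - m + min m c`.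
    have hmin : ∀ (m : Fin (k + 1) → ℕ) (c : ℕ),
        ∑ i : Fin k, min ((G.verts.card : ℤ) - c) (G.verts.card - m i.succ) =
          k * G.verts.card - k * c - ∑ i : Fin k, (m i.succ : ℤ) +
            ∑ i : Fin k, min (m i.succ : ℤ) c := by
      intro m c
      rw [← hconst, ← hconst, ← sum_sub_distrib, ← sum_sub_distrib, ← sum_add_distrib]
      exact sum_congr rfl fun i _ => by omega
    -- Root bounds become edge bounds by complementing in `|V|`. The total is chosen so that there
    -- are exactly `ℓ' 0` roots, and the lower bound follows from `ℓ 0 ≤ ℓ' 0`.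
    obtain ⟨B, S, hBS, hS, hsum⟩ := G.exists_isSpanningPacking hV
      (fun i : Fin k => (G.verts.card : ℤ) - ℓ' i.succ) (fun i => (G.verts.card : ℤ) - ℓ i.succ)
      (fun i => by have := heach i; omega) (fun i => by have := heach i; omega)
      (k * G.verts.card - ℓ' 0)
      (by rw [sum_sub_distrib, hconst]; omega)
      (fun P => by
        have := h₁ P
        rw [hmin]
        omega)
      (fun P => by
        have := h₂ P
        rw [hmin, sum_sub_distrib, hconst]
        omega)
    have htot : (∑ i, ((S i).card : ℤ)) = ℓ' 0 := by
      rw [sum_sub_distrib, hconst] at hsum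
      omega
    have htot' : ∑ i, (S i).card = ℓ' 0 := by exact_mod_cast htot
    refine ⟨B, S, hBS, fun i => ?_, htot' ▸ htotal.2.1, htot'.le⟩
    have := hS i
    omega
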